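/- Let $\alpha>0$ be a real number, let $\varphi:\mathbb R\to\mathbb R$ be a $C^\infty$ function with compact support, and put $$I_\alpha(t)=\int_0^\infty \exp\!\left(\frac{it}{x^{\alpha}}\right)\varphi(x)\,dx\qquad(t\in\mathbb R).$$ For each integer $n\ge 1$ define $$A_n=\frac{e^{-\frac{n}{2\alpha}\pi i}}{\alpha}\,\frac{\varphi^{(n-1)}(0)}{(n-1)!}\,\Gamma\!\left(-\frac n\alpha\right)\ \text{ if } \frac n\alpha\notin\mathbb N,\qquad A_n=0\ \text{ if }\frac n\alpha\in\mathbb N,$$ $$B_n=\frac{-1}{\alpha}\,\frac{\varphi^{(n-1)}(0)}{(n-1)!}\,\frac{i^{\,n/\alpha}}{(n/\alpha)!}\ \text{ if } \frac n\alpha\in\mathbb N,\qquad B_n=0\ \text{ if }\frac n\alpha\notin\mathbb N.$$ (i) If $\alpha$ is rational, then for every integer $N\ge 1$ there is a function $\psi_N:[0,\infty)\to\mathbb C$ of class $C^{\lceil (N+1)/\alpha\rceil-1}$ on the closed half-line $[0,\infty)$ (with one-sided derivatives at $0$) such that $$I_\alpha(t)=\sum_{n=1}^N A_n t^{n/\alpha}+\sum_{n=1}^N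 B_n t^{n/\alpha}\log t+\psi_N(t)\qquad\text{for all } t\ge 0,$$ where $t^{n/\alpha}\log t$ is understood as $0$ at $t=0$. (ii) If $\alpha$ is irrational, then for every integer $N\ge 1$ there is a function $\phi_N:\mathbb R\to\mathbb C$ of class $C^{\lceil (N+1)/\alpha\rceil-1}$ on $\mathbb R$ such that $$I_\alpha(t)=\sum_{n=1}^N A_n t^{n/\alpha}+\phi_N(t)$$ for all $t\ge 0$, and also for all $t<0$ when $t^{n/\alpha}$ is read there as $e^{in\pi/\alpha}|t|^{n/\alpha}$. -/

import Mathlib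

open scoped ContDiff

noncomputable section

/-- The oscillatory integral `I_α(t) = ∫_0^∞ exp(i t / x^α) φ(x) dx`. -/
def oscIntegral (α : ℝ) (φ : ℝ → ℝ) (t : ℝ) : ℂ :=
  ∫ x in Set.Ioi (0 : ℝ), Complex.exp (Complex.I * ((t * (1 / x ^ α) : ℝ) : ℂ)) * (φ x : ℂ)

open Classical in
/-- The coefficient `A_n` of `t^(n/α)`, for `n ≥ 1`. -/
def coeffA (α : ℝ) (φ : ℝ → ℝ) (n : ℕ) : ℂ :=
  if ∃ m : ℕ, (n : ℝ) / α = m then 0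
  else Complex.exp (-((((n : ℝ) / (2 * α) * Real.pi : ℝ) : ℂ) * Complex.I)) / (α : ℂ)
    * (((iteratedDeriv (n - 1) φ 0 / ((n - 1).factorial : ℝ) : ℝ) : ℂ))
    * ((Real.Gamma (-((n : ℝ) / α)) : ℝ) : ℂ)

open Classical in
/-- The coefficient `B_n` of `t^(n/α) log t`, for `n ≥ 1`. In the first branch `n / α` is a
natural number, so it is equal to its floor. -/
def coeffB (α : ℝ) (φ : ℝ → ℝ) (n : ℕ) : ℂ :=
  if ∃ m : ℕ, (n : ℝ) / α = m then
    (-1 / (α : ℂ)) * (((iteratedDeriv (n - 1) φ 0 / ((n - 1).factorial : ℝ) : ℝ) : ℂ))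
      * (Complex.I ^ ⌊(n : ℝ) / α⌋₊ / ((⌊(n : ℝ) / α⌋₊.factorial : ℕ) : ℂ))
  else 0

end

/-! Only the behaviour of `φ` at the origin creates singularities of the integral at `t = 0`. On
`(0, 1]` subtract from `φ` its Taylor polynomial of degree `N - 1`. The remainder is `O(x^N)` at
`0`, so its moments against `x^(-kα)` converge exactly in the range `kα < N + 1`. Differentiating
under the integral sign therefore gives a function of class `C^K`, with `K = ⌈(N+1)/α⌉ - 1` the
largest such `k` (`oscIntegral_eq_sum_tailIntegral`).

The substitution `u = x^(-α)` turns the monomial `x^(n-1)` on `(0, 1]` into `1/α` times the tail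
integral `T_s(t) = ∫_1^∞ e^{itu} u^{-s-1} du` with `s = n/α`. Modulo smooth functions, `T_s` is
`Γ(-s) (-it)^s` when `s` is not an integer (`tailIntegral_of_not_nat`), and `-(i^m / m!) t^m log t`
on `t ≥ 0` when `s = m` (`tailIntegral_nat`). These are the sources of `A_n` and `B_n`. The
recursion `(s+1) T_{s+1} = e^{it} + it T_s` reduces both claims to `0 < s ≤ 1`.

For `0 < s < 1`, subtracting `1` from the exponential makes the integral converge at `0`. The
integral over the half-line is then a regularised Gamma integral, and the part over `(0, 1]` is
smooth in `t`. For `s = 1` the logarithm comes from an explicit primitive. -/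

section

open MeasureTheory Filter Topology Set

/-! ### Smooth dependence of oscillatory integrals on the parameter -/

/-- Differentiation under the integral sign for `∫ (exp (i t g) - c) f`. -/
theorem hasDerivAt_integral_exp_sub_mul {μ : Measure ℝ} {g : ℝ → ℝ} (hg : Measurable g)
    {f : ℝ → ℂ} (hf : AEStronglyMeasurable f μ) (c : ℂ) (t : ℝ)
    (hint : Integrable (fun x => (Complex.exp (Complex.I * ((t * g x : ℝ) : ℂ)) - c) * f x) μ)
    (hgf : Integrable (fun x => (g x : ℂ) * f x) μ) :
    HasDerivAt (fun t : ℝ => ∫ x, (Complex.exp (Complex.I * ((t * g x : ℝ) : ℂ)) - c) * f x ∂μ)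
      (∫ x, Complex.exp (Complex.I * ((t * g x : ℝ) : ℂ)) * (Complex.I * ((g x : ℂ) * f x)) ∂μ)
      t := by
  have hmeas : ∀ t : ℝ, AEStronglyMeasurable
      (fun x => Complex.exp (Complex.I * ((t * g x : ℝ) : ℂ))) μ := fun t =>
    Measurable.aestronglyMeasurable (by fun_prop)
  refine (hasDerivAt_integral_of_dominated_loc_of_deriv_le (s := univ)
    (F := fun (t : ℝ) x => (Complex.exp (Complex.I * ((t * g x : ℝ) : ℂ)) - c) * f x)
    (F' := fun (t : ℝ) x =>
      Complex.exp (Complex.I * ((t * g x : ℝ) : ℂ)) * (Complex.I * ((g x : ℂ) * f x)))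
    (bound := fun x => ‖(g x : ℂ) * f x‖) univ_mem (Eventually.of_forall fun t => ?_) hint ?_
    (ae_of_all _ fun x t _ => ?_) hgf.norm (ae_of_all _ fun x t _ => ?_)).2
  · exact ((hmeas t).sub aestronglyMeasurable_const).mul hf
  · exact (hmeas t).mul (hgf.1.const_mul _)
  · rw [norm_mul, Complex.norm_exp_I_mul_ofReal, norm_mul, Complex.norm_I, one_mul, one_mul]
  · have h1 : HasDerivAt (fun t : ℝ => ((t * g x : ℝ) : ℂ)) (g x : ℂ) t := by
      simpa using ((hasDerivAt_id t).mul_const (g x)).ofReal_comp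
    have h2 := (((h1.const_mul Complex.I).cexp).sub_const c).mul_const (f x)
    refine h2.congr_deriv ?_
    ring

/-- Smoothness of `∫ exp (i t g) f` when enough moments of `f` with respect to `g` exist. -/
theorem contDiff_integral_exp_mul {μ : Measure ℝ} {g : ℝ → ℝ} (hg : Measurable g) (K : ℕ)
    {f : ℝ → ℂ} (hf : ∀ k ≤ K, Integrable (fun x => (g x : ℂ) ^ k * f x) μ) :
    ContDiff ℝ K (fun t : ℝ => ∫ x, Complex.exp (Complex.I * ((t * g x : ℝ) : ℂ)) * f x ∂μ) := by
  have hmeas : ∀ t : ℝ, AEStronglyMeasurable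
      (fun x => Complex.exp (Complex.I * ((t * g x : ℝ) : ℂ))) μ := fun t =>
    Measurable.aestronglyMeasurable (by fun_prop)
  induction K generalizing f with
  | zero =>
    have h0 : Integrable f μ := by simpa using hf 0 le_rfl
    refine contDiff_zero.2 (continuous_of_dominated (bound := fun x => ‖f x‖)
      (fun t => (hmeas t).mul h0.1) (fun t => ae_of_all _ fun x => ?_) h0.norm
      (ae_of_all _ fun x => by fun_prop))
    rw [norm_mul, Complex.norm_exp_I_mul_ofReal, one_mul]
  | succ K ih =>
    have h0 : Integrable f μ := by simpa using hf 0 (Nat.zero_le _)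
    have h1 : Integrable (fun x => (g x : ℂ) * f x) μ := by simpa using hf 1 (by omega)
    have hd : ∀ t : ℝ, HasDerivAt
        (fun t : ℝ => ∫ x, Complex.exp (Complex.I * ((t * g x : ℝ) : ℂ)) * f x ∂μ)
        (∫ x, Complex.exp (Complex.I * ((t * g x : ℝ) : ℂ)) * (Complex.I * ((g x : ℂ) * f x)) ∂μ)
        t := fun t => by
      have hi : Integrable (fun x => (Complex.exp (Complex.I * ((t * g x : ℝ) : ℂ)) - 0) * f x) μ := by
        simp only [sub_zero]
        refine h0.bdd_mul (c := 1) (hmeas t) (ae_of_all _ fun x => ?_)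
        rw [Complex.norm_exp_I_mul_ofReal]
      simpa only [sub_zero] using hasDerivAt_integral_exp_sub_mul hg h0.1 0 t hi h1
    rw [show ((K + 1 : ℕ) : WithTop ℕ∞) = (K : WithTop ℕ∞) + 1 by norm_cast,
      contDiff_succ_iff_deriv]
    refine ⟨fun t => (hd t).differentiableAt, fun h => by simp at h, ?_⟩
    rw [funext fun t => (hd t).deriv]
    refine ih fun k hk => ?_
    have := (hf (k + 1) (by omega)).const_mul Complex.I
    refine this.congr (ae_of_all _ fun x => ?_)
    simp only
    ring

/-- The truncated singular integral `∫_0^1 (exp (i t u) - 1) u^{-s-1} du` is smooth in `t`. -/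
theorem contDiff_integral_exp_sub_one_mul_rpow {s : ℝ} (hs : s < 1) :
    (∀ t : ℝ, HasDerivAt (fun t : ℝ => ∫ u in Ioc (0 : ℝ) 1,
      (Complex.exp (Complex.I * ((t * u : ℝ) : ℂ)) - 1) * ((u ^ (-s - 1) : ℝ) : ℂ))
      (∫ u in Ioc (0 : ℝ) 1,
        Complex.exp (Complex.I * ((t * u : ℝ) : ℂ)) * (Complex.I * ((u ^ (-s) : ℝ) : ℂ))) t) ∧
    (∀ t : ℝ, IntegrableOn (fun u : ℝ =>
      (Complex.exp (Complex.I * ((t * u : ℝ) : ℂ)) - 1) * ((u ^ (-s - 1) : ℝ) : ℂ)) (Ioc 0 1)) ∧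
    ContDiff ℝ (⊤ : ℕ∞) (fun t : ℝ => ∫ u in Ioc (0 : ℝ) 1,
      (Complex.exp (Complex.I * ((t * u : ℝ) : ℂ)) - 1) * ((u ^ (-s - 1) : ℝ) : ℂ)) := by
  have hrpow : ∀ u ∈ Ioc (0 : ℝ) 1, u * u ^ (-s - 1) = u ^ (-s) := fun u hu => by
    rw [Real.rpow_sub_one hu.1.ne']
    field_simp [hu.1.ne']
  have hreal : IntegrableOn (fun u : ℝ => u ^ (-s)) (Ioc 0 1) :=
    (intervalIntegrable_iff_integrableOn_Ioc_of_le (zero_le_one' ℝ)).1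
      (intervalIntegral.intervalIntegrable_rpow' (by linarith))
  have hcplx : IntegrableOn (fun u : ℝ => ((u ^ (-s) : ℝ) : ℂ)) (Ioc 0 1) := hreal.ofReal
  have hmeasf : Measurable (fun u : ℝ => ((u ^ (-s - 1) : ℝ) : ℂ)) := by fun_prop
  have hgf : IntegrableOn (fun u : ℝ => (u : ℂ) * ((u ^ (-s - 1) : ℝ) : ℂ)) (Ioc 0 1) :=
    hcplx.congr_fun (fun u hu => by
      simp only [← Complex.ofReal_mul, hrpow u hu]) measurableSet_Ioc
  have hint : ∀ t : ℝ, IntegrableOn (fun u : ℝ =>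
      (Complex.exp (Complex.I * ((t * u : ℝ) : ℂ)) - 1) * ((u ^ (-s - 1) : ℝ) : ℂ))
      (Ioc 0 1) := fun t => by
    refine Integrable.mono' (hreal.const_mul |t|) (Measurable.aestronglyMeasurable (by fun_prop)) ?_
    filter_upwards [ae_restrict_mem measurableSet_Ioc] with u hu
    rw [norm_mul, Complex.norm_real, Real.norm_of_nonneg (Real.rpow_nonneg hu.1.le _),
      ← hrpow u hu, ← mul_assoc]
    refine mul_le_mul_of_nonneg_right ?_ (Real.rpow_nonneg hu.1.le _)
    refine Real.norm_exp_I_mul_ofReal_sub_one_le.trans ?_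
    rw [Real.norm_eq_abs, abs_mul, abs_of_pos hu.1]
  have hd : ∀ t : ℝ, HasDerivAt (fun t : ℝ => ∫ u in Ioc (0 : ℝ) 1,
      (Complex.exp (Complex.I * ((t * u : ℝ) : ℂ)) - 1) * ((u ^ (-s - 1) : ℝ) : ℂ))
      (∫ u in Ioc (0 : ℝ) 1,
        Complex.exp (Complex.I * ((t * u : ℝ) : ℂ)) * (Complex.I * ((u ^ (-s) : ℝ) : ℂ))) t :=
    fun t => by
    have := hasDerivAt_integral_exp_sub_mul (μ := volume.restrict (Ioc 0 1)) measurable_id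
      hmeasf.aestronglyMeasurable 1 t (hint t) hgf
    refine this.congr_deriv (setIntegral_congr_fun measurableSet_Ioc fun u hu => ?_)
    simp only [id, ← Complex.ofReal_mul, hrpow u hu]
  refine ⟨hd, hint, ?_⟩
  -- Only the first derivative needs the subtracted `1`. After it the weight is `i u^(-s)`,
  -- integrable on `(0, 1]`, and further factors `u ≤ 1` keep it so.
  rw [contDiff_infty_iff_deriv]
  refine ⟨fun t => (hd t).differentiableAt, ?_⟩
  rw [funext fun t => (hd t).deriv, contDiff_infty]
  intro K
  refine contDiff_integral_exp_mul (μ := volume.restrict (Ioc 0 1)) measurable_id K fun k _ => ?_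
  refine (hcplx.const_mul Complex.I).bdd_mul (c := 1)
    (Measurable.aestronglyMeasurable (by fun_prop)) ?_
  filter_upwards [ae_restrict_mem measurableSet_Ioc] with u hu
  rw [norm_pow, Complex.norm_real, id, Real.norm_of_nonneg hu.1.le]
  exact pow_le_one₀ hu.1.le hu.2

/-! ### The regularised Gamma integral for `0 < s < 1` -/

theorem norm_exp_sub_one_le_of_re_nonpos {z : ℂ} (hz : z.re ≤ 0) :
    ‖Complex.exp z - 1‖ ≤ 2 ∧ ‖Complex.exp z - 1‖ ≤ 2 * ‖z‖ := by
  have h2 : ‖Complex.exp z - 1‖ ≤ 2 := by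
    refine (norm_sub_le _ _).trans ?_
    rw [Complex.norm_exp, norm_one]
    linarith [Real.exp_le_one_iff.2 hz]
  refine ⟨h2, ?_⟩
  rcases le_total ‖z‖ 1 with h | h
  · exact Complex.norm_exp_sub_one_le h
  · linarith

/-- A dominating function for `(exp (-r u) - 1) u^{-s-1}` on the half-line. -/
theorem integrableOn_min_mul_rpow {s : ℝ} (hs0 : 0 < s) (hs1 : s < 1) (C : ℝ) (hC : 0 ≤ C) :
    IntegrableOn (fun u : ℝ => min 2 (C * u) * u ^ (-s - 1)) (Ioi 0) := by
  rw [← Ioc_union_Ioi_eq_Ioi zero_le_one]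
  refine IntegrableOn.union ?_ ?_
  · have hreal : IntegrableOn (fun u : ℝ => C * u ^ (-s)) (Ioc 0 1) :=
      ((intervalIntegrable_iff_integrableOn_Ioc_of_le (zero_le_one' ℝ)).1
        (intervalIntegral.intervalIntegrable_rpow' (by linarith))).const_mul C
    refine Integrable.mono' hreal (Measurable.aestronglyMeasurable (by fun_prop)) ?_
    filter_upwards [ae_restrict_mem measurableSet_Ioc] with u hu
    have hp := Real.rpow_nonneg hu.1.le (-s - 1)
    have hCu : 0 ≤ C * u := mul_nonneg hC hu.1.le
    rw [Real.norm_of_nonneg (mul_nonneg (le_min zero_le_two hCu) hp)]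
    refine (mul_le_mul_of_nonneg_right (min_le_right _ _) hp).trans (le_of_eq ?_)
    rw [Real.rpow_sub_one hu.1.ne']
    field_simp [hu.1.ne']
  · refine Integrable.mono' ((integrableOn_Ioi_rpow_of_lt (a := -s - 1) (by linarith)
      zero_lt_one).const_mul 2) (Measurable.aestronglyMeasurable (by fun_prop)) ?_
    filter_upwards [ae_restrict_mem measurableSet_Ioi] with u hu
    have hu0 : (0 : ℝ) < u := zero_lt_one.trans hu
    have hp := Real.rpow_nonneg hu0.le (-s - 1)
    rw [Real.norm_of_nonneg (mul_nonneg (le_min zero_le_two (mul_nonneg hC hu0.le)) hp)]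
    exact mul_le_mul_of_nonneg_right (min_le_left _ _) hp

/-- The majorant depends on `r` only through a bound on `‖r‖` and covers the closed half-plane, so
it survives the passage to the imaginary axis. -/
theorem norm_exp_neg_mul_sub_one_mul_rpow_le {s : ℝ} {r : ℂ} (hr : 0 ≤ r.re) {C : ℝ}
    (hC : 2 * ‖r‖ ≤ C) {u : ℝ} (hu : 0 < u) :
    ‖(Complex.exp (-(r * u)) - 1) * ((u ^ (-s - 1) : ℝ) : ℂ)‖ ≤ min 2 (C * u) * u ^ (-s - 1) := by
  have hz : (-(r * u)).re ≤ 0 := by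
    simpa using mul_nonneg hr hu.le
  obtain ⟨h1, h2⟩ := norm_exp_sub_one_le_of_re_nonpos hz
  rw [norm_mul, Complex.norm_real, Real.norm_of_nonneg (Real.rpow_nonneg hu.le _)]
  refine mul_le_mul_of_nonneg_right (le_min h1 (h2.trans ?_)) (Real.rpow_nonneg hu.le _)
  rw [norm_neg, norm_mul, Complex.norm_real, Real.norm_of_nonneg hu.le, ← mul_assoc]
  exact mul_le_mul_of_nonneg_right hC hu.le

theorem integrableOn_exp_neg_mul_sub_one_mul_rpow {s : ℝ} (hs0 : 0 < s) (hs1 : s < 1) {r : ℂ}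
    (hr : 0 ≤ r.re) :
    IntegrableOn (fun u : ℝ => (Complex.exp (-(r * u)) - 1) * ((u ^ (-s - 1) : ℝ) : ℂ))
      (Ioi 0) := by
  refine Integrable.mono' (integrableOn_min_mul_rpow hs0 hs1 (2 * ‖r‖) (by positivity))
    (Measurable.aestronglyMeasurable (by fun_prop)) ?_
  filter_upwards [ae_restrict_mem measurableSet_Ioi] with u hu
  exact norm_exp_neg_mul_sub_one_mul_rpow_le hr le_rfl hu

theorem integrableOn_rpow_mul_exp_neg {s δ : ℝ} (hs1 : s < 1) (hδ : 0 < δ) :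
    IntegrableOn (fun u : ℝ => u ^ (-s) * Real.exp (-δ * u)) (Ioi 0) := by
  simpa using integrableOn_rpow_mul_exp_neg_mul_rpow (p := 1) (s := -s) (b := δ)
    (by linarith) one_pos hδ

theorem differentiableAt_integral_exp_neg_sub_one {s : ℝ} (hs0 : 0 < s) (hs1 : s < 1) {r : ℂ}
    (hr : 0 < r.re) :
    DifferentiableAt ℂ (fun r : ℂ =>
      ∫ u in Ioi (0 : ℝ), (Complex.exp (-(r * u)) - 1) * ((u ^ (-s - 1) : ℝ) : ℂ)) r := by
  -- Staying at real part above `r.re / 2` gives one exponential decay rate for all nearby `z`.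
  have hopen : {z : ℂ | r.re / 2 < z.re} ∈ 𝓝 r :=
    (isOpen_lt continuous_const Complex.continuous_re).mem_nhds (by simp; linarith)
  refine (hasDerivAt_integral_of_dominated_loc_of_deriv_le (s := {z : ℂ | r.re / 2 < z.re})
    (μ := volume.restrict (Ioi (0 : ℝ)))
    (bound := fun u : ℝ => u ^ (-s) * Real.exp (-(r.re / 2) * u))
    (F := fun (z : ℂ) (u : ℝ) => (Complex.exp (-(z * u)) - 1) * ((u ^ (-s - 1) : ℝ) : ℂ))
    (F' := fun (z : ℂ) (u : ℝ) => Complex.exp (-(z * u)) * (-u) * ((u ^ (-s - 1) : ℝ) : ℂ))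
    hopen (Eventually.of_forall fun t => Measurable.aestronglyMeasurable (by fun_prop))
    (integrableOn_exp_neg_mul_sub_one_mul_rpow hs0 hs1 hr.le)
    (Measurable.aestronglyMeasurable (by fun_prop)) ?_
    (integrableOn_rpow_mul_exp_neg hs1 (by linarith)) ?_).2.differentiableAt
  · filter_upwards [ae_restrict_mem measurableSet_Ioi] with u hu z hz
    have hu : 0 < u := hu
    have hz : r.re / 2 < z.re := hz
    rw [norm_mul, norm_mul, Complex.norm_exp, norm_neg, Complex.norm_real, Complex.norm_real,
      Real.norm_of_nonneg hu.le, Real.norm_of_nonneg (Real.rpow_nonneg hu.le _), mul_assoc,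
      show u * u ^ (-s - 1) = u ^ (-s) by
        rw [Real.rpow_sub_one hu.ne']; field_simp [hu.ne'], mul_comm]
    refine mul_le_mul_of_nonneg_left (Real.exp_le_exp.2 ?_) (Real.rpow_nonneg hu.le _)
    simp
    nlinarith
  · refine ae_of_all _ fun u z _ => ?_
    have h1 : HasDerivAt (fun z : ℂ => -(z * u)) (-(u : ℂ)) z := by
      simpa using! ((hasDerivAt_id z).mul_const (u : ℂ)).neg
    exact (h1.cexp.sub_const 1).mul_const _

/-- The regularised Gamma integral on the positive half-line. -/
theorem integral_exp_neg_sub_one_mul_rpow_of_pos {s : ℝ} (hs0 : 0 < s) (hs1 : s < 1) {r : ℝ}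
    (hr : 0 < r) :
    ∫ u in Ioi (0 : ℝ), (Complex.exp (-((r : ℂ) * u)) - 1) * ((u ^ (-s - 1) : ℝ) : ℂ) =
      (((r ^ s) * Real.Gamma (-s) : ℝ) : ℂ) := by
  have hI : ∀ u : ℝ, (Complex.exp (-((r : ℂ) * u)) - 1) * ((u ^ (-s - 1) : ℝ) : ℂ) =
      (((Real.exp (-(r * u)) - 1) * u ^ (-s - 1) : ℝ) : ℂ) := fun u => by push_cast; rfl
  simp_rw [hI]
  rw [integral_complex_ofReal]
  congr 1
  have hint : IntegrableOn (fun u : ℝ => (Real.exp (-(r * u)) - 1) * u ^ (-s - 1)) (Ioi 0) := by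
    have := (integrableOn_exp_neg_mul_sub_one_mul_rpow hs0 hs1 (r := r) (by simpa using hr.le)).re
    refine this.congr (ae_of_all _ fun u => ?_)
    simp only [hI]
    exact Complex.ofReal_re _
  have hbound : ∀ u : ℝ, 0 < u → |Real.exp (-(r * u)) - 1| ≤ 2 ∧
      |Real.exp (-(r * u)) - 1| ≤ 2 * (r * u) := fun u hu => by
    obtain ⟨h1, h2⟩ := norm_exp_sub_one_le_of_re_nonpos (z := ((-(r * u) : ℝ) : ℂ))
      (by simpa using (mul_pos hr hu).le)
    rw [← Complex.ofReal_exp, ← Complex.ofReal_one, ← Complex.ofReal_sub, Complex.norm_real,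
      Real.norm_eq_abs] at h1 h2
    rw [Complex.norm_real, norm_neg, Real.norm_of_nonneg (mul_pos hr hu).le] at h2
    exact ⟨h1, h2⟩
  -- With primitive `-u^(-s)/s`, the boundary terms are `O(u^(1-s))` at `0` and `O(u^(-s))` at
  -- infinity, so both vanish because `0 < s < 1`.
  have hparts := integral_Ioi_mul_deriv_eq_deriv_mul (a := 0) (a' := 0) (b' := 0)
    (u := fun u : ℝ => Real.exp (-(r * u)) - 1) (v := fun u : ℝ => -s⁻¹ * u ^ (-s))
    (u' := fun u : ℝ => -r * Real.exp (-(r * u))) (v' := fun u : ℝ => u ^ (-s - 1))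
    (fun u _ => by
      have h1 : HasDerivAt (fun u : ℝ => -(r * u)) (-r) u := by
        simpa using! ((hasDerivAt_id u).const_mul r).neg
      exact (h1.exp.sub_const 1).congr_deriv (by ring))
    (fun u hu => by
      have := (Real.hasDerivAt_rpow_const (x := u) (p := -s) (Or.inl (ne_of_gt hu))).const_mul (-s⁻¹)
      exact this.congr_deriv (by field_simp))
    hint
    (by
      refine ((integrableOn_rpow_mul_exp_neg hs1 hr).const_mul (r * s⁻¹)).congr
        (ae_of_all _ fun u => ?_)
      simp only [Pi.mul_apply, neg_mul]
      ring)
    (by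
      have hlim : Tendsto (fun u : ℝ => 2 * r * s⁻¹ * u ^ (1 - s)) (𝓝[>] 0) (𝓝 0) := by
        have : Tendsto (fun u : ℝ => 2 * r * s⁻¹ * u ^ (1 - s)) (𝓝 0)
            (𝓝 (2 * r * s⁻¹ * (0 : ℝ) ^ (1 - s))) :=
          ((Real.continuousAt_rpow_const 0 (1 - s) (Or.inr (by linarith))).tendsto).const_mul _
        rw [Real.zero_rpow (by linarith), mul_zero] at this
        exact this.mono_left nhdsWithin_le_nhds
      refine squeeze_zero_norm' ?_ hlim
      filter_upwards [self_mem_nhdsWithin] with u hu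
      have hu : 0 < u := hu
      have h := (hbound u hu).2
      have hp := Real.rpow_nonneg hu.le (-s)
      rw [Pi.mul_apply, norm_mul, norm_mul, Real.norm_eq_abs, norm_neg,
        Real.norm_of_nonneg hp, Real.norm_of_nonneg (inv_pos.2 hs0).le]
      calc _ ≤ 2 * (r * u) * (s⁻¹ * u ^ (-s)) :=
            mul_le_mul_of_nonneg_right h (mul_nonneg (inv_pos.2 hs0).le hp)
        _ = 2 * r * s⁻¹ * (u ^ (-s) * u) := by ring
        _ = _ := by rw [← Real.rpow_add_one hu.ne', show -s + 1 = 1 - s by ring])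
    (by
      have hlim : Tendsto (fun u : ℝ => 2 * s⁻¹ * u ^ (-s)) atTop (𝓝 0) := by
        simpa using (tendsto_rpow_neg_atTop hs0).const_mul (2 * s⁻¹)
      refine squeeze_zero_norm' ?_ hlim
      filter_upwards [eventually_gt_atTop 0] with u hu
      have h := (hbound u hu).1
      have hp := Real.rpow_nonneg hu.le (-s)
      rw [Pi.mul_apply, norm_mul, norm_mul, Real.norm_eq_abs, norm_neg,
        Real.norm_of_nonneg hp, Real.norm_of_nonneg (inv_pos.2 hs0).le, mul_assoc]
      exact mul_le_mul_of_nonneg_right h (mul_nonneg (inv_pos.2 hs0).le hp))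
  rw [hparts]
  have hG := Real.integral_rpow_mul_exp_neg_mul_Ioi (a := 1 - s) (r := r) (by linarith) hr
  have hG' : ∫ u in Ioi (0 : ℝ), -r * Real.exp (-(r * u)) * (-s⁻¹ * u ^ (-s)) =
      r * s⁻¹ * ((1 / r) ^ (1 - s) * Real.Gamma (1 - s)) := by
    rw [← hG, ← integral_const_mul]
    congr 1 with u
    rw [show 1 - s - 1 = -s by ring]
    ring
  rw [hG', show 1 - s = -s + 1 by ring, Real.Gamma_add_one (by linarith), one_div,
    Real.inv_rpow hr.le, Real.rpow_add_one hr.ne', Real.rpow_neg hr.le]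
  field_simp
  ring

/-- The regularised Gamma integral on the right half-plane. -/
theorem integral_exp_neg_sub_one_mul_rpow_of_re_pos {s : ℝ} (hs0 : 0 < s) (hs1 : s < 1) {r : ℂ}
    (hr : 0 < r.re) :
    ∫ u in Ioi (0 : ℝ), (Complex.exp (-(r * u)) - 1) * ((u ^ (-s - 1) : ℝ) : ℂ) =
      r ^ (s : ℂ) * ((Real.Gamma (-s) : ℝ) : ℂ) := by
  have hopen : IsOpen {z : ℂ | 0 < z.re} := isOpen_lt continuous_const Complex.continuous_re
  have hF : AnalyticOnNhd ℂ (fun r : ℂ =>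
      ∫ u in Ioi (0 : ℝ), (Complex.exp (-(r * u)) - 1) * ((u ^ (-s - 1) : ℝ) : ℂ))
      {z : ℂ | 0 < z.re} :=
    DifferentiableOn.analyticOnNhd (fun z hz =>
      (differentiableAt_integral_exp_neg_sub_one hs0 hs1 hz).differentiableWithinAt) hopen
  have hH : AnalyticOnNhd ℂ (fun r : ℂ => r ^ (s : ℂ) * ((Real.Gamma (-s) : ℝ) : ℂ))
      {z : ℂ | 0 < z.re} :=
    DifferentiableOn.analyticOnNhd (fun z hz => by
      have : z ∈ Complex.slitPlane := Or.inl hz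
      exact ((differentiableAt_id.cpow_const this).mul_const _).differentiableWithinAt) hopen
  -- Identity theorem: both sides agree at real points accumulating at `1` from the right.
  refine hF.eqOn_of_preconnected_of_frequently_eq hH
    (convex_halfSpace_re_gt 0).isPreconnected (z₀ := 1) (by simp) ?_ hr
  have hmap : Tendsto (fun x : ℝ => (x : ℂ)) (𝓝[>] 1) (𝓝[≠] 1) := by
    refine tendsto_nhdsWithin_iff.2 ⟨?_, ?_⟩
    · exact (Complex.continuous_ofReal.tendsto' 1 1 (by simp)).mono_left nhdsWithin_le_nhds
    · filter_upwards [self_mem_nhdsWithin] with x hx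
      have : (1 : ℝ) < x := hx
      simpa using this.ne'
  refine hmap.frequently (Eventually.frequently ?_)
  filter_upwards [self_mem_nhdsWithin] with x hx
  have hx0 : (0 : ℝ) < x := zero_lt_one.trans hx
  rw [integral_exp_neg_sub_one_mul_rpow_of_pos hs0 hs1 hx0, Complex.ofReal_mul,
    Complex.ofReal_cpow hx0.le]

/-- The regularised Gamma integral on the imaginary axis. -/
theorem integral_exp_mul_I_sub_one_mul_rpow {s : ℝ} (hs0 : 0 < s) (hs1 : s < 1) {t : ℝ}
    (ht : t ≠ 0) :
    ∫ u in Ioi (0 : ℝ), (Complex.exp (Complex.I * ((t * u : ℝ) : ℂ)) - 1) *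
      ((u ^ (-s - 1) : ℝ) : ℂ) = (-(Complex.I * t)) ^ (s : ℂ) * ((Real.Gamma (-s) : ℝ) : ℂ) := by
  -- For `t ≠ 0` the boundary point is off the branch cut, so the power is continuous there and the
  -- formula passes to the limit `ε → 0+`.
  have hslit : -(Complex.I * t) ∈ Complex.slitPlane := Or.inr (by simpa using ht)
  have hpath : Tendsto (fun ε : ℝ => (ε : ℂ) - Complex.I * t) (𝓝[>] 0) (𝓝 (-(Complex.I * t))) := by
    have : Tendsto (fun ε : ℝ => (ε : ℂ) - Complex.I * t) (𝓝 0)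
        (𝓝 (((0 : ℝ) : ℂ) - Complex.I * t)) := Continuous.tendsto (by fun_prop) 0
    simpa using this.mono_left nhdsWithin_le_nhds
  have hlim1 : Tendsto (fun ε : ℝ => ((ε : ℂ) - Complex.I * t) ^ (s : ℂ) *
      ((Real.Gamma (-s) : ℝ) : ℂ)) (𝓝[>] 0)
      (𝓝 ((-(Complex.I * t)) ^ (s : ℂ) * ((Real.Gamma (-s) : ℝ) : ℂ))) :=
    ((continuousAt_cpow_const hslit).tendsto.comp hpath).mul_const _
  have hlim2 : Tendsto (fun ε : ℝ => ∫ u in Ioi (0 : ℝ),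
      (Complex.exp (-(((ε : ℂ) - Complex.I * t) * u)) - 1) * ((u ^ (-s - 1) : ℝ) : ℂ)) (𝓝[>] 0)
      (𝓝 (∫ u in Ioi (0 : ℝ), (Complex.exp (Complex.I * ((t * u : ℝ) : ℂ)) - 1) *
        ((u ^ (-s - 1) : ℝ) : ℂ))) := by
    refine tendsto_integral_filter_of_dominated_convergence
      (fun u => min 2 (2 * (1 + |t|) * u) * u ^ (-s - 1))
      (Eventually.of_forall fun ε => Measurable.aestronglyMeasurable (by fun_prop)) ?_
      (integrableOn_min_mul_rpow hs0 hs1 _ (by positivity)) (ae_of_all _ fun u => ?_)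
    · filter_upwards [Ioo_mem_nhdsGT (zero_lt_one' ℝ)] with ε hε
      filter_upwards [ae_restrict_mem measurableSet_Ioi] with u hu
      refine norm_exp_neg_mul_sub_one_mul_rpow_le (by simpa using hε.1.le) ?_ hu
      refine mul_le_mul_of_nonneg_left ((norm_sub_le _ _).trans ?_) zero_le_two
      simpa [abs_of_pos hε.1] using hε.2.le
    · have h : Tendsto (fun z : ℂ => (Complex.exp (-(z * u)) - 1) * ((u ^ (-s - 1) : ℝ) : ℂ))
          (𝓝 (-(Complex.I * t)))
          (𝓝 ((Complex.exp (-(-(Complex.I * t) * u)) - 1) * ((u ^ (-s - 1) : ℝ) : ℂ))) :=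
        Continuous.tendsto (by fun_prop) _
      have := h.comp hpath
      rw [show -(-(Complex.I * t) * u) = Complex.I * ((t * u : ℝ) : ℂ) by push_cast; ring] at this
      exact this
  refine tendsto_nhds_unique (hlim2.congr' ?_) hlim1
  filter_upwards [self_mem_nhdsWithin] with ε hε
  exact integral_exp_neg_sub_one_mul_rpow_of_re_pos hs0 hs1 (by simpa using hε)

/-! ### The tail integral: recursion and non-integral exponents -/

/-- The tail integral `∫_1^∞ exp (i t u) u^{-s-1} du`. -/
noncomputable def tailIntegral (s t : ℝ) : ℂ :=
  ∫ u in Ioi (1 : ℝ), Complex.exp (Complex.I * ((t * u : ℝ) : ℂ)) * ((u ^ (-s - 1) : ℝ) : ℂ)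

theorem integrableOn_exp_mul_rpow {s : ℝ} (hs : 0 < s) (t : ℝ) {c : ℝ} (hc : 0 < c) :
    IntegrableOn (fun u : ℝ => Complex.exp (Complex.I * ((t * u : ℝ) : ℂ)) *
      ((u ^ (-s - 1) : ℝ) : ℂ)) (Ioi c) := by
  have h : IntegrableOn (fun u : ℝ => ((u ^ (-s - 1) : ℝ) : ℂ)) (Ioi c) :=
    (integrableOn_Ioi_rpow_of_lt (by linarith) hc).ofReal
  refine h.bdd_mul (c := 1) (Measurable.aestronglyMeasurable (by fun_prop))
    (ae_of_all _ fun u => ?_)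
  rw [Complex.norm_exp_I_mul_ofReal]

theorem integral_Ioi_one_rpow {s : ℝ} (hs : 0 < s) :
    ∫ u in Ioi (1 : ℝ), ((u ^ (-s - 1) : ℝ) : ℂ) = 1 / (s : ℂ) := by
  rw [integral_complex_ofReal, integral_Ioi_rpow_of_lt (by linarith) one_pos]
  rw [show -s - 1 + 1 = -s by ring]
  push_cast
  simp

theorem hasDerivAt_exp_I_mul (t u : ℝ) :
    HasDerivAt (fun u : ℝ => Complex.exp (Complex.I * ((t * u : ℝ) : ℂ)))
      (Complex.I * t * Complex.exp (Complex.I * ((t * u : ℝ) : ℂ))) u := by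
  have h1 : HasDerivAt (fun u : ℝ => ((t * u : ℝ) : ℂ)) (t : ℂ) u := by
    simpa using! ((hasDerivAt_id u).const_mul t).ofReal_comp
  exact (h1.const_mul Complex.I).cexp.congr_deriv (by ring)

/-- Integration by parts lowers the exponent of the tail integral. -/
theorem tailIntegral_add_one {s : ℝ} (hs : 0 < s) (t : ℝ) :
    tailIntegral (s + 1) t =
      (Complex.exp (Complex.I * t) + Complex.I * t * tailIntegral s t) / ((s : ℂ) + 1) := by
  have hs1 : (s : ℂ) + 1 ≠ 0 := by
    exact_mod_cast (by linarith : s + 1 ≠ 0)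
  have hv : ∀ u ∈ Ioi (1 : ℝ), HasDerivAt
      (fun u : ℝ => -((s : ℂ) + 1)⁻¹ * ((u ^ (-s - 1) : ℝ) : ℂ))
      ((u ^ (-(s + 1) - 1) : ℝ) : ℂ) u := fun u hu => by
    have hu0 : (0 : ℝ) < u := zero_lt_one.trans hu
    have := ((Real.hasDerivAt_rpow_const (x := u) (p := -s - 1)
      (Or.inl hu0.ne')).ofReal_comp).const_mul (-((s : ℂ) + 1)⁻¹)
    refine this.congr_deriv ?_
    rw [show -(s + 1) - 1 = -s - 1 - 1 by ring]
    push_cast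
    field_simp
    ring
  have hcont : Continuous (fun u : ℝ => Complex.exp (Complex.I * ((t * u : ℝ) : ℂ))) := by fun_prop
  have hparts := integral_Ioi_mul_deriv_eq_deriv_mul (a := 1)
    (a' := Complex.exp (Complex.I * t) * -((s : ℂ) + 1)⁻¹) (b' := 0)
    (fun u _ => hasDerivAt_exp_I_mul t u) hv
    (integrableOn_exp_mul_rpow (by linarith) t one_pos)
    (by
      refine ((integrableOn_exp_mul_rpow hs t one_pos).const_mul
        (-(Complex.I * t * ((s : ℂ) + 1)⁻¹))).congr (ae_of_all _ fun u => ?_)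
      simp only [Pi.mul_apply]
      ring)
    (by
      have h1 : ContinuousAt (fun u : ℝ => Complex.exp (Complex.I * ((t * u : ℝ) : ℂ)) *
          (-((s : ℂ) + 1)⁻¹ * ((u ^ (-s - 1) : ℝ) : ℂ))) 1 :=
        hcont.continuousAt.mul (continuousAt_const.mul
          (Complex.continuous_ofReal.continuousAt.comp
            (Real.continuousAt_rpow_const 1 (-s - 1) (Or.inl one_ne_zero))))
      have h2 := h1.tendsto.mono_left (nhdsWithin_le_nhds (s := Ioi 1))
      rw [mul_one, Real.one_rpow, Complex.ofReal_one, mul_one] at h2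
      exact h2)
    (by
      have hlim : Tendsto (fun u : ℝ => ‖-((s : ℂ) + 1)⁻¹‖ * u ^ (-s - 1)) atTop (𝓝 0) := by
        have := (tendsto_rpow_neg_atTop (y := s + 1) (by linarith)).const_mul
          ‖-((s : ℂ) + 1)⁻¹‖
        rw [mul_zero] at this
        refine this.congr fun u => ?_
        rw [show -(s + 1) = -s - 1 by ring]
      refine squeeze_zero_norm' ?_ hlim
      filter_upwards [eventually_gt_atTop 0] with u hu
      rw [Pi.mul_apply, norm_mul, norm_mul, Complex.norm_exp_I_mul_ofReal, one_mul,
        Complex.norm_real, Real.norm_of_nonneg (Real.rpow_nonneg hu.le _)])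
  rw [tailIntegral, hparts]
  have : ∫ u in Ioi (1 : ℝ), Complex.I * t * Complex.exp (Complex.I * ((t * u : ℝ) : ℂ)) *
      (-((s : ℂ) + 1)⁻¹ * ((u ^ (-s - 1) : ℝ) : ℂ)) =
      -(Complex.I * t * ((s : ℂ) + 1)⁻¹) * tailIntegral s t := by
    rw [tailIntegral, ← integral_const_mul]
    congr 1 with u
    ring
  rw [this]
  field_simp
  ring

/-- Writing `e^{itu} = (e^{itu} - 1) + 1`, the tail is the regularised integral over the half-line,
minus its smooth part over `(0, 1]`, plus `∫_1^∞ u^{-s-1} du = 1/s`. -/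
theorem tailIntegral_of_lt_one {s : ℝ} (hs0 : 0 < s) (hs1 : s < 1) :
    ∃ G : ℝ → ℂ, ContDiff ℝ (⊤ : ℕ∞) G ∧ ∀ t : ℝ,
      tailIntegral s t = (-(Complex.I * t)) ^ (s : ℂ) * ((Real.Gamma (-s) : ℝ) : ℂ) + G t := by
  obtain ⟨-, hint, hsmooth⟩ := contDiff_integral_exp_sub_one_mul_rpow hs1
  refine ⟨_, (contDiff_const (c := 1 / (s : ℂ))).sub hsmooth, fun t => ?_⟩
  have htail : IntegrableOn (fun u : ℝ => (Complex.exp (Complex.I * ((t * u : ℝ) : ℂ)) - 1) *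
      ((u ^ (-s - 1) : ℝ) : ℂ)) (Ioi 1) := by
    have h := (integrableOn_exp_mul_rpow hs0 t one_pos).sub
      (integrableOn_exp_mul_rpow hs0 0 one_pos)
    refine h.congr (ae_of_all _ fun u => ?_)
    simp [sub_mul]
  have hsplit : ∫ u in Ioi (1 : ℝ), (Complex.exp (Complex.I * ((t * u : ℝ) : ℂ)) - 1) *
      ((u ^ (-s - 1) : ℝ) : ℂ) = tailIntegral s t - 1 / (s : ℂ) := by
    rw [← integral_Ioi_one_rpow hs0, tailIntegral,
      ← integral_sub (integrableOn_exp_mul_rpow hs0 t one_pos)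
        (by simpa [IntegrableOn] using integrableOn_exp_mul_rpow hs0 0 one_pos)]
    congr 1 with u
    ring
  have hadd := setIntegral_union (Ioc_disjoint_Ioi le_rfl) measurableSet_Ioi (hint t) htail
  rw [Ioc_union_Ioi_eq_Ioi zero_le_one, hsplit] at hadd
  have hmain : ∫ u in Ioi (0 : ℝ), (Complex.exp (Complex.I * ((t * u : ℝ) : ℂ)) - 1) *
      ((u ^ (-s - 1) : ℝ) : ℂ) = (-(Complex.I * t)) ^ (s : ℂ) * ((Real.Gamma (-s) : ℝ) : ℂ) := by
    rcases eq_or_ne t 0 with rfl | ht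
    · simp [Complex.zero_cpow (Complex.ofReal_ne_zero.2 hs0.ne')]
    · exact integral_exp_mul_I_sub_one_mul_rpow hs0 hs1 ht
  rw [← hmain, hadd]
  ring

/-- Singular expansion of the tail integral at a non-integral exponent. -/
theorem tailIntegral_of_not_nat {s : ℝ} (hs : 0 < s) (hn : ¬ ∃ m : ℕ, s = m) :
    ∃ G : ℝ → ℂ, ContDiff ℝ (⊤ : ℕ∞) G ∧ ∀ t : ℝ,
      tailIntegral s t = (-(Complex.I * t)) ^ (s : ℂ) * ((Real.Gamma (-s) : ℝ) : ℂ) + G t := by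
  have key : ∀ (n : ℕ) (a : ℝ), 0 < a → a < 1 → ∃ G : ℝ → ℂ, ContDiff ℝ (⊤ : ℕ∞) G ∧
      ∀ t : ℝ, tailIntegral (a + n) t = (-(Complex.I * t)) ^ ((a + n : ℝ) : ℂ) *
        ((Real.Gamma (-(a + n)) : ℝ) : ℂ) + G t := by
    intro n a ha0 ha1
    induction n with
    | zero => simpa using tailIntegral_of_lt_one ha0 ha1
    | succ n ih =>
      obtain ⟨G, hG, hGt⟩ := ih
      have hpos : 0 < a + n := by positivity
      refine ⟨fun t => (Complex.exp (Complex.I * t) + Complex.I * t * G t) /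
        (((a + n : ℝ) : ℂ) + 1), ?_, fun t => ?_⟩
      · have h1 : ContDiff ℝ (⊤ : ℕ∞) (fun t : ℝ => (t : ℂ)) := Complex.ofRealCLM.contDiff
        exact (((contDiff_const.mul h1).cexp).add ((contDiff_const.mul h1).mul hG)).div_const _
      · have hne : ((a + n : ℝ) : ℂ) + 1 ≠ 0 := by
          exact_mod_cast (by positivity : a + n + 1 ≠ 0)
        -- The recursion multiplies the singular term by `it/(s+1)` with `s = a + n`. The functional
        -- equation of `Γ` absorbs `-1/(s+1)`, and the remaining `-it` raises the power by one.
        have hΓ : Real.Gamma (-(a + n)) = -(a + n + 1) * Real.Gamma (-(a + n + 1)) := by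
          rw [← Real.Gamma_add_one (by linarith)]
          congr 1
          ring
        have hcpow : (-(Complex.I * t)) ^ ((a + n + 1 : ℝ) : ℂ) =
            (-(Complex.I * t)) ^ ((a + n : ℝ) : ℂ) * (-(Complex.I * t)) := by
          rcases eq_or_ne t 0 with rfl | ht
          · simp only [Complex.ofReal_zero, mul_zero, neg_zero]
            exact Complex.zero_cpow (by exact_mod_cast hne)
          · rw [Complex.ofReal_add, Complex.ofReal_one, Complex.cpow_add _ _
              (neg_ne_zero.2 (mul_ne_zero Complex.I_ne_zero (Complex.ofReal_ne_zero.2 ht))),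
              Complex.cpow_one]
        rw [Nat.cast_succ, ← add_assoc, tailIntegral_add_one hpos, hGt, hcpow, hΓ]
        push_cast at hne ⊢
        field_simp
        ring
  have hfloor := Nat.floor_le hs.le
  have hlt : (⌊s⌋₊ : ℝ) < s := lt_of_le_of_ne hfloor fun h => hn ⟨_, h.symm⟩
  simpa using key ⌊s⌋₊ (s - ⌊s⌋₊) (by linarith) (by linarith [Nat.lt_floor_add_one s])

/-! ### The tail integral at integral exponents: the logarithm -/

/-- The scaling `v = tu` moves `t` from the phase into the limit of integration, where the
fundamental theorem of calculus applies. -/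
theorem tailIntegral_one_eq_mul_integral {t : ℝ} (ht : 0 < t) :
    tailIntegral 1 t = t * ∫ v in Ioi t, Complex.exp (Complex.I * v) * ((v ^ (-2 : ℝ) : ℝ) : ℂ) := by
  have h := integral_comp_mul_left_Ioi
    (fun v : ℝ => Complex.exp (Complex.I * v) * ((v ^ (-2 : ℝ) : ℝ) : ℂ)) 1 ht
  rw [mul_one] at h
  have h2 : tailIntegral 1 t = ((t ^ 2 : ℝ) : ℂ) * ∫ u in Ioi (1 : ℝ),
      Complex.exp (Complex.I * ((t * u : ℝ) : ℂ)) * (((t * u) ^ (-2 : ℝ) : ℝ) : ℂ) := by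
    rw [← integral_const_mul, tailIntegral]
    refine setIntegral_congr_fun measurableSet_Ioi fun u hu => ?_
    have hu0 : (0 : ℝ) < u := zero_lt_one.trans hu
    have : u ^ (-1 - 1 : ℝ) = t ^ 2 * (t * u) ^ (-2 : ℝ) := by
      rw [Real.mul_rpow ht.le hu0.le, show (-1 - 1 : ℝ) = -2 by norm_num, Real.rpow_neg ht.le,
        Real.rpow_two]
      field_simp
    simp only [this]
    push_cast
    ring
  rw [h2, h, Complex.real_smul]
  push_cast
  field_simp

theorem hasDerivAt_integral_Ioi {f : ℝ → ℂ} (hf : ContinuousOn f (Ioi 0))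
    (hint : ∀ c : ℝ, 0 < c → IntegrableOn f (Ioi c)) {t : ℝ} (ht : 0 < t) :
    HasDerivAt (fun t : ℝ => ∫ v in Ioi t, f v) (-f t) t := by
  have hat : ContinuousAt f t := hf.continuousAt (Ioi_mem_nhds ht)
  have hsm : StronglyMeasurableAtFilter f (𝓝 t) volume :=
    hf.stronglyMeasurableAtFilter isOpen_Ioi t ht
  have hI : IntervalIntegrable f volume (t / 2) t :=
    ((hint (t / 4) (by linarith)).mono_set fun x hx => by
      rw [uIcc_of_le (by linarith)] at hx
      exact lt_of_lt_of_le (by linarith) hx.1).intervalIntegrable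
  have h := (intervalIntegral.integral_hasDerivAt_right hI hsm hat).const_sub
    (∫ v in Ioi (t / 2), f v)
  refine h.congr_of_eventuallyEq ?_
  filter_upwards [Ioi_mem_nhds (show t / 2 < t by linarith)] with x hx
  have hx : t / 2 < x := hx
  rw [intervalIntegral.integral_of_le hx.le,
    ← Ioc_union_Ioi_eq_Ioi hx.le, setIntegral_union (Ioc_disjoint_Ioi le_rfl) measurableSet_Ioi
      ((hint _ (by linarith)).mono_set Ioc_subset_Ioi_self) (hint x (by linarith))]
  ring

theorem tailIntegral_one :
    ∃ G : ℝ → ℂ, ContDiff ℝ (⊤ : ℕ∞) G ∧ ∀ t : ℝ, 0 ≤ t →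
      tailIntegral 1 t = -Complex.I * ((t * Real.log t : ℝ) : ℂ) + G t := by
  obtain ⟨hd, -, hsmooth⟩ := contDiff_integral_exp_sub_one_mul_rpow (s := 0) one_pos
  set J : ℝ → ℂ := fun t => ∫ u in Ioc (0 : ℝ) 1,
    (Complex.exp (Complex.I * ((t * u : ℝ) : ℂ)) - 1) * ((u ^ (-(0 : ℝ) - 1) : ℝ) : ℂ) with hJ
  have hJd : ∀ t : ℝ, 0 < t → HasDerivAt J ((Complex.exp (Complex.I * t) - 1) / t) t := by
    intro t ht
    have htc : (t : ℂ) ≠ 0 := Complex.ofReal_ne_zero.2 ht.ne'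
    refine (hd t).congr_deriv ?_
    -- At `s = 0` the differentiated integrand is `i e^{itu}`, whose integral over `(0, 1]` is
    -- elementary.
    have h := integral_exp_mul_complex (a := 0) (b := 1) (mul_ne_zero Complex.I_ne_zero htc)
    rw [intervalIntegral.integral_of_le zero_le_one] at h
    have h2 : ∫ u in Ioc (0 : ℝ) 1, Complex.exp (Complex.I * ((t * u : ℝ) : ℂ)) *
        (Complex.I * ((u ^ (-(0 : ℝ)) : ℝ) : ℂ)) =
        Complex.I * ∫ u in Ioc (0 : ℝ) 1, Complex.exp (Complex.I * t * u) := by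
      rw [← integral_const_mul]
      congr 1 with u
      rw [neg_zero, Real.rpow_zero]
      push_cast
      ring_nf
    rw [h2, h]
    field_simp [Complex.I_ne_zero]
    simp
  set V : ℝ → ℂ := fun t => ∫ v in Ioi t, Complex.exp (Complex.I * v) * ((v ^ (-2 : ℝ) : ℝ) : ℂ)
    with hV
  have hVd : ∀ t : ℝ, 0 < t →
      HasDerivAt V (-(Complex.exp (Complex.I * t) * ((t ^ (-2 : ℝ) : ℝ) : ℂ))) t := by
    intro t ht
    refine hasDerivAt_integral_Ioi
      (f := fun v : ℝ => Complex.exp (Complex.I * v) * ((v ^ (-2 : ℝ) : ℝ) : ℂ)) ?_ ?_ ht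
    · refine ContinuousOn.mul (by fun_prop) (Complex.continuous_ofReal.comp_continuousOn ?_)
      exact continuousOn_id.rpow_const fun x hx => Or.inl (ne_of_gt hx)
    · intro c hc
      have := integrableOn_exp_mul_rpow one_pos 1 hc
      simp only [one_mul] at this
      rwa [show (-1 - 1 : ℝ) = -2 by norm_num] at this
  -- `V' = -e^{it}/t²`. The term `-e^{it}/t` cancels the double pole but leaves `-i e^{it}/t`, which
  -- `i J'` reduces to `-i/t`, and `i log t` removes that.
  set W : ℝ → ℂ := fun t => V t + Complex.I * (Real.log t : ℂ) -
    Complex.exp (Complex.I * t) / t + Complex.I * J t with hW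
  have hWd : ∀ t ∈ Ioi (0 : ℝ), HasDerivAt W 0 t := by
    intro t ht
    have ht : 0 < t := ht
    have htc : (t : ℂ) ≠ 0 := Complex.ofReal_ne_zero.2 ht.ne'
    have hexp : HasDerivAt (fun t : ℝ => Complex.exp (Complex.I * t))
        (Complex.I * Complex.exp (Complex.I * t)) t := by
      simpa using hasDerivAt_exp_I_mul 1 t
    have hid : HasDerivAt (fun t : ℝ => (t : ℂ)) 1 t := by
      simpa using! (hasDerivAt_id t).ofReal_comp
    have h := (((hVd t ht).add ((Real.hasDerivAt_log ht.ne').ofReal_comp.const_mul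
      Complex.I)).sub (hexp.div hid htc)).add ((hJd t ht).const_mul Complex.I)
    refine h.congr_deriv ?_
    rw [Real.rpow_neg ht.le, Real.rpow_two]
    push_cast
    field_simp
    ring
  have hconst : ∀ t : ℝ, 0 < t → W t = W 1 := fun t ht =>
    isOpen_Ioi.is_const_of_deriv_eq_zero isPreconnected_Ioi
      (fun x hx => (hWd x hx).differentiableAt.differentiableWithinAt)
      (fun x hx => (hWd x hx).deriv) ht (mem_Ioi.2 one_pos)
  -- Solve `W t = W 1` for `V t` and multiply by `t`; everything except the logarithmic term is
  -- smooth on the whole line.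
  refine ⟨fun t => Complex.exp (Complex.I * t) - Complex.I * t * J t + t * W 1, ?_, ?_⟩
  · have h1 : ContDiff ℝ (⊤ : ℕ∞) (fun t : ℝ => (t : ℂ)) := Complex.ofRealCLM.contDiff
    exact (((contDiff_const.mul h1).cexp).sub ((contDiff_const.mul h1).mul hsmooth)).add
      (h1.mul contDiff_const)
  · intro t ht
    rcases ht.eq_or_lt with rfl | ht
    · have h := integral_Ioi_one_rpow one_pos
      simp only [tailIntegral, zero_mul, Complex.ofReal_zero, mul_zero, Complex.exp_zero, one_mul,
        h]
      simp
    · have htc : (t : ℂ) ≠ 0 := Complex.ofReal_ne_zero.2 ht.ne'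
      rw [tailIntegral_one_eq_mul_integral ht, ← hconst t ht]
      simp only [hW, hV]
      push_cast
      field_simp
      ring

/-- Singular expansion of the tail integral at a positive integral exponent. -/
theorem tailIntegral_nat (m : ℕ) (hm : 1 ≤ m) :
    ∃ G : ℝ → ℂ, ContDiff ℝ (⊤ : ℕ∞) G ∧ ∀ t : ℝ, 0 ≤ t →
      tailIntegral m t = -(Complex.I ^ m / (m.factorial : ℂ)) *
        ((t ^ (m : ℝ) * Real.log t : ℝ) : ℂ) + G t := by
  induction m, hm using Nat.le_induction with
  | base => simpa using tailIntegral_one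
  | succ m hm ih =>
    obtain ⟨G, hG, hGt⟩ := ih
    refine ⟨fun t => (Complex.exp (Complex.I * t) + Complex.I * t * G t) / ((m : ℂ) + 1), ?_,
      fun t ht => ?_⟩
    · have h1 : ContDiff ℝ (⊤ : ℕ∞) (fun t : ℝ => (t : ℂ)) := Complex.ofRealCLM.contDiff
      exact (((contDiff_const.mul h1).cexp).add ((contDiff_const.mul h1).mul hG)).div_const _
    · have hpos : (0 : ℝ) < m := by exact_mod_cast hm
      have hne : (m : ℂ) + 1 ≠ 0 := by exact_mod_cast m.succ_ne_zero
      have hfac : ((m.factorial : ℕ) : ℂ) ≠ 0 := by exact_mod_cast m.factorial_ne_zero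
      rw [Nat.cast_succ, tailIntegral_add_one hpos, hGt t ht, Nat.factorial_succ, ← Nat.cast_succ,
        Real.rpow_natCast, Real.rpow_natCast, Nat.succ_eq_add_one]
      push_cast
      field_simp
      ring

/-! ### Taylor expansion at the origin and reduction to tail integrals -/

theorem sum_Icc_one_comp_pred {M : Type*} [AddCommMonoid M] (f : ℕ → M) (N : ℕ) :
    ∑ n ∈ Finset.Icc 1 N, f (n - 1) = ∑ k ∈ Finset.range N, f k := by
  induction N with
  | zero => simp
  | succ N ih => rw [Finset.sum_Icc_succ_top (by omega), Finset.sum_range_succ, ih]; rfl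

/-- The Taylor coefficient of order `n - 1` at the origin. -/
noncomputable def taylorCoeff (φ : ℝ → ℝ) (n : ℕ) : ℝ :=
  iteratedDeriv (n - 1) φ 0 / ((n - 1).factorial : ℝ)

theorem exists_taylor_bound {φ : ℝ → ℝ} (hφ : ContDiff ℝ ∞ φ) {N : ℕ} (hN : 1 ≤ N) :
    ∃ C : ℝ, ∀ x ∈ Icc (0 : ℝ) 1,
      |φ x - ∑ n ∈ Finset.Icc 1 N, taylorCoeff φ n * x ^ (n - 1)| ≤ C * x ^ N := by
  obtain ⟨M, rfl⟩ := Nat.exists_eq_add_of_le' hN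
  obtain ⟨C, hC⟩ := exists_taylor_mean_remainder_bound (f := φ) (n := M) (zero_le_one' ℝ)
    ((hφ.of_le (by exact_mod_cast le_top)).contDiffOn)
  refine ⟨C, fun x hx => ?_⟩
  have h := hC x hx
  rw [taylor_within_apply, sub_zero, Real.norm_eq_abs] at h
  simp only [taylorCoeff]
  rw [sum_Icc_one_comp_pred (fun k => iteratedDeriv k φ 0 / (k.factorial : ℝ) * x ^ k)]
  refine le_of_eq_of_le ?_ h
  congr 2
  refine Finset.sum_congr rfl fun k _ => ?_
  -- Taylor's theorem on `[0, 1]` uses one-sided derivatives at `0`; smoothness of `φ` on the line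
  -- identifies them with the two-sided ones.
  rw [iteratedDerivWithin_eq_iteratedDeriv (uniqueDiffOn_Icc zero_lt_one)
    (hφ.contDiffAt.of_le (by exact_mod_cast le_top)) (left_mem_Icc.2 zero_le_one), smul_eq_mul]
  ring

theorem integral_exp_inv_rpow_mul_pow {α : ℝ} (hα : 0 < α) {n : ℕ} (hn : 1 ≤ n) (t : ℝ) :
    ∫ x in Ioc (0 : ℝ) 1, Complex.exp (Complex.I * ((t * (1 / x ^ α) : ℝ) : ℂ)) *
      ((x ^ (n - 1) : ℝ) : ℂ) = (1 / (α : ℂ)) * tailIntegral (n / α) t := by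
  have hαc : (α : ℂ) ≠ 0 := Complex.ofReal_ne_zero.2 hα.ne'
  set h : ℝ → ℂ := fun u => Complex.exp (Complex.I * ((t * u : ℝ) : ℂ)) *
    ((u ^ (-(n / α) - 1) : ℝ) : ℂ) with hh
  -- The change of variables `u = x^(-α)` is available on the full half-line; the indicator of `u >
  -- 1` cuts it down to `0 < x < 1`.
  have hsub := integral_comp_rpow_Ioi ((Ioi (1 : ℝ)).indicator h) (neg_ne_zero.2 hα.ne')
  rw [setIntegral_indicator measurableSet_Ioi, Ioi_inter_Ioi, sup_eq_right.2 (zero_le_one' ℝ)] at hsub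
  have hcongr : ∫ x in Ioi (0 : ℝ), (|(-α)| * x ^ (-α - 1)) • (Ioi (1 : ℝ)).indicator h (x ^ (-α)) =
      ∫ x in Ioi (0 : ℝ), (Iio (1 : ℝ)).indicator (fun x => (α : ℂ) *
        (Complex.exp (Complex.I * ((t * (1 / x ^ α) : ℝ) : ℂ)) * ((x ^ (n - 1) : ℝ) : ℂ))) x := by
    refine setIntegral_congr_fun measurableSet_Ioi fun x hx => ?_
    have hx : 0 < x := hx
    by_cases hx1 : x < 1
    · have h1 : x ^ (-α) ∈ Ioi (1 : ℝ) :=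
        Real.one_lt_rpow_of_pos_of_lt_one_of_neg hx hx1 (neg_lt_zero.2 hα)
      rw [indicator_of_mem h1, indicator_of_mem (show x ∈ Iio (1 : ℝ) from hx1), abs_neg,
        abs_of_pos hα, hh]
      simp only
      have hpow : x ^ (-α - 1) * (x ^ (-α)) ^ (-((n : ℝ) / α) - 1) = x ^ (n - 1) := by
        rw [← Real.rpow_mul hx.le, ← Real.rpow_add hx, ← Real.rpow_natCast, Nat.cast_sub hn]
        congr 1
        push_cast
        field_simp
        ring
      rw [Complex.real_smul, ← hpow, Real.rpow_neg hx.le α, one_div]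
      push_cast
      ring
    · have h1 : x ^ (-α) ∉ Ioi (1 : ℝ) := by
        rw [mem_Ioi, not_lt]
        exact Real.rpow_le_one_of_one_le_of_nonpos (not_lt.1 hx1) (neg_nonpos.2 hα.le)
      rw [indicator_of_notMem h1, indicator_of_notMem (show x ∉ Iio (1 : ℝ) from hx1), smul_zero]
  rw [hcongr, setIntegral_indicator measurableSet_Iio, Ioi_inter_Iio, integral_const_mul] at hsub
  rw [integral_Ioc_eq_integral_Ioo, tailIntegral, ← hsub]
  field_simp

/-- Moments of the Taylor remainder with respect to the phase. -/
theorem integrableOn_inv_rpow_pow_mul_remainder {α : ℝ} (hα : 0 < α) {φ : ℝ → ℝ}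
    (hφ : ContDiff ℝ ∞ φ) (hφc : HasCompactSupport φ) {N : ℕ} (hN : 1 ≤ N) {k : ℕ}
    (hk : (k : ℝ) < ((N : ℝ) + 1) / α) :
    IntegrableOn (fun x : ℝ => ((1 / x ^ α : ℝ) : ℂ) ^ k * ((φ x - (Iic (1 : ℝ)).indicator
      (fun x => ∑ n ∈ Finset.Icc 1 N, taylorCoeff φ n * x ^ (n - 1)) x : ℝ) : ℂ)) (Ioi 0) := by
  obtain ⟨C, hC⟩ := exists_taylor_bound hφ hN
  have hφint : Integrable φ := hφ.continuous.integrable_of_hasCompactSupport hφc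
  have hφm : Measurable φ := hφ.continuous.measurable
  have hpm : Measurable (fun x : ℝ => ∑ n ∈ Finset.Icc 1 N, taylorCoeff φ n * x ^ (n - 1)) := by
    fun_prop
  have hm : Measurable (fun x : ℝ => ((1 / x ^ α : ℝ) : ℂ) ^ k *
      ((φ x - (Iic (1 : ℝ)).indicator
        (fun x => ∑ n ∈ Finset.Icc 1 N, taylorCoeff φ n * x ^ (n - 1)) x : ℝ) : ℂ)) := by
    have h1 := hφm.sub (hpm.indicator (measurableSet_Iic (a := (1 : ℝ))))
    have h2 : Measurable (fun x : ℝ => ((1 / x ^ α : ℝ) : ℂ) ^ k) := by fun_prop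
    exact h2.mul (Complex.measurable_ofReal.comp h1)
  -- In the form `kα < N + 1`, the hypothesis is the integrability condition for `x^(N - kα)` at
  -- `0`.
  rw [lt_div_iff₀ hα] at hk
  rw [← Ioc_union_Ioi_eq_Ioi zero_le_one]
  refine IntegrableOn.union ?_ ?_
  · have hreal : IntegrableOn (fun x : ℝ => C * x ^ ((N : ℝ) - k * α)) (Ioc 0 1) :=
      ((intervalIntegrable_iff_integrableOn_Ioc_of_le (zero_le_one' ℝ)).1
        (intervalIntegral.intervalIntegrable_rpow' (by linarith))).const_mul C
    refine Integrable.mono' hreal hm.aestronglyMeasurable ?_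
    filter_upwards [ae_restrict_mem measurableSet_Ioc] with x hx
    rw [indicator_of_mem (show x ∈ Iic (1 : ℝ) from hx.2), norm_mul, norm_pow, Complex.norm_real,
      Complex.norm_real, Real.norm_eq_abs, Real.norm_eq_abs,
      abs_of_pos (one_div_pos.2 (Real.rpow_pos_of_pos hx.1 α))]
    have h := hC x ⟨hx.1.le, hx.2⟩
    have hp : 0 ≤ (1 / x ^ α) ^ k := by
      have := Real.rpow_pos_of_pos hx.1 α
      positivity
    refine (mul_le_mul_of_nonneg_left h hp).trans (le_of_eq ?_)
    rw [Real.rpow_sub hx.1, mul_comm (k : ℝ) α, Real.rpow_mul hx.1.le, Real.rpow_natCast,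
      Real.rpow_natCast, one_div, inv_pow]
    ring
  · refine Integrable.mono' hφint.norm.integrableOn hm.aestronglyMeasurable ?_
    filter_upwards [ae_restrict_mem measurableSet_Ioi] with x hx
    have hx : 1 < x := hx
    have hx0 : 0 < x := zero_lt_one.trans hx
    rw [indicator_of_notMem (show x ∉ Iic (1 : ℝ) from not_le.2 hx), sub_zero, norm_mul, norm_pow,
      Complex.norm_real, Complex.norm_real]
    refine mul_le_of_le_one_left (norm_nonneg _) (pow_le_one₀ (norm_nonneg _) ?_)
    rw [Real.norm_of_nonneg (one_div_pos.2 (Real.rpow_pos_of_pos hx0 α)).le]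
    exact (div_le_one (Real.rpow_pos_of_pos hx0 α)).2 (Real.one_le_rpow hx.le hα.le)

/-- The oscillatory integral is a combination of tail integrals up to a `C^K` remainder. -/
theorem oscIntegral_eq_sum_tailIntegral {α : ℝ} (hα : 0 < α) {φ : ℝ → ℝ}
    (hφ : ContDiff ℝ ∞ φ) (hφc : HasCompactSupport φ) {N : ℕ} (hN : 1 ≤ N) :
    ∃ R : ℝ → ℂ, ContDiff ℝ ((⌈((N : ℝ) + 1) / α⌉₊ - 1 : ℕ) : WithTop ℕ∞) R ∧
      ∀ t : ℝ, oscIntegral α φ t = ∑ n ∈ Finset.Icc 1 N,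
        ((taylorCoeff φ n : ℝ) : ℂ) / α * tailIntegral (n / α) t + R t := by
  have hgm : Measurable (fun x : ℝ => 1 / x ^ α) := by fun_prop
  -- Positivity keeps the natural subtraction from truncating, so `k ≤ ⌈(N+1)/α⌉ - 1` does mean `k <
  -- (N+1)/α`.
  have hceil : 0 < ⌈((N : ℝ) + 1) / α⌉₊ := Nat.ceil_pos.2 (by positivity)
  have hmom : ∀ k ≤ ⌈((N : ℝ) + 1) / α⌉₊ - 1, _ := fun k hk =>
    integrableOn_inv_rpow_pow_mul_remainder hα hφ hφc hN (k := k) (Nat.lt_ceil.1 (by omega))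
  refine ⟨_, contDiff_integral_exp_mul (μ := volume.restrict (Ioi 0)) hgm _ hmom, fun t => ?_⟩
  have hem : Measurable (fun x : ℝ => Complex.exp (Complex.I * ((t * (1 / x ^ α) : ℝ) : ℂ))) := by
    fun_prop
  have hbdd : ∀ {f : ℝ → ℂ} {s : Set ℝ}, IntegrableOn f s → IntegrableOn (fun x : ℝ =>
      Complex.exp (Complex.I * ((t * (1 / x ^ α) : ℝ) : ℂ)) * f x) s := fun hf =>
    hf.bdd_mul (c := 1) hem.aestronglyMeasurable
      (ae_of_all _ fun x => by rw [Complex.norm_exp_I_mul_ofReal])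
  have hr := hmom 0 (Nat.zero_le _)
  simp only [pow_zero, one_mul] at hr
  have hφint : IntegrableOn (fun x => (φ x : ℂ)) (Ioi 0) :=
    (hφ.continuous.integrable_of_hasCompactSupport hφc).ofReal.integrableOn
  have hsum : ∫ x in Ioi (0 : ℝ), Complex.exp (Complex.I * ((t * (1 / x ^ α) : ℝ) : ℂ)) *
      (((Iic (1 : ℝ)).indicator
        (fun x => ∑ n ∈ Finset.Icc 1 N, taylorCoeff φ n * x ^ (n - 1)) x : ℝ) : ℂ) =
      ∑ n ∈ Finset.Icc 1 N, ((taylorCoeff φ n : ℝ) : ℂ) / α * tailIntegral (n / α) t := by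
    have h1 : ∀ x : ℝ, Complex.exp (Complex.I * ((t * (1 / x ^ α) : ℝ) : ℂ)) *
        (((Iic (1 : ℝ)).indicator
          (fun x => ∑ n ∈ Finset.Icc 1 N, taylorCoeff φ n * x ^ (n - 1)) x : ℝ) : ℂ) =
        (Iic (1 : ℝ)).indicator (fun x => ∑ n ∈ Finset.Icc 1 N, (taylorCoeff φ n : ℂ) *
          (Complex.exp (Complex.I * ((t * (1 / x ^ α) : ℝ) : ℂ)) *
            ((x ^ (n - 1) : ℝ) : ℂ))) x := by
      intro x
      by_cases hx : x ∈ Iic (1 : ℝ)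
      · rw [indicator_of_mem hx, indicator_of_mem hx, Complex.ofReal_sum, Finset.mul_sum]
        refine Finset.sum_congr rfl fun n _ => ?_
        rw [Complex.ofReal_mul (taylorCoeff φ n)]
        ring
      · rw [indicator_of_notMem hx, indicator_of_notMem hx, Complex.ofReal_zero, mul_zero]
    simp_rw [h1]
    rw [setIntegral_indicator measurableSet_Iic, Ioi_inter_Iic, integral_finsetSum]
    · refine Finset.sum_congr rfl fun n hn => ?_
      rw [integral_const_mul, integral_exp_inv_rpow_mul_pow hα (Finset.mem_Icc.1 hn).1]
      ring
    · intro n _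
      refine (hbdd ?_).const_mul _
      have : Continuous (fun x : ℝ => ((x ^ (n - 1) : ℝ) : ℂ)) := by fun_prop
      exact this.integrableOn_Ioc
  rw [← hsum, ← integral_add ?_ (hbdd hr), oscIntegral]
  · congr 1 with x
    push_cast
    ring
  · refine hbdd ((hφint.sub hr).congr (ae_of_all _ fun x => ?_))
    simp

/-! ### Branches of the power and assembly of the expansion -/

/-- On the principal branch `-it` has argument `-π/2` for `t > 0`, and `π/2` for `t < 0` in the
companion lemma. -/
theorem neg_I_mul_cpow_of_pos {t : ℝ} (ht : 0 < t) (s : ℝ) :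
    (-(Complex.I * t)) ^ (s : ℂ) =
      ((t ^ s : ℝ) : ℂ) * Complex.exp (-((s * Real.pi / 2 : ℝ) : ℂ) * Complex.I) := by
  have h0 : (t : ℂ) * -Complex.I ≠ 0 :=
    mul_ne_zero (Complex.ofReal_ne_zero.2 ht.ne') (neg_ne_zero.2 Complex.I_ne_zero)
  rw [show -(Complex.I * t) = t * -Complex.I by ring, Complex.cpow_def_of_ne_zero h0,
    Complex.log_ofReal_mul ht (neg_ne_zero.2 Complex.I_ne_zero), Complex.log_neg_I,
    Real.rpow_def_of_pos ht, Complex.ofReal_exp, ← Complex.exp_add]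
  congr 1
  push_cast
  ring

theorem neg_I_mul_cpow_of_neg {t : ℝ} (ht : t < 0) (s : ℝ) :
    (-(Complex.I * t)) ^ (s : ℂ) =
      ((|t| ^ s : ℝ) : ℂ) * Complex.exp (((s * Real.pi / 2 : ℝ) : ℂ) * Complex.I) := by
  have ht' : 0 < |t| := abs_pos.2 ht.ne
  have h0 : ((|t| : ℝ) : ℂ) * Complex.I ≠ 0 :=
    mul_ne_zero (Complex.ofReal_ne_zero.2 ht'.ne') Complex.I_ne_zero
  rw [show -(Complex.I * t) = ((|t| : ℝ) : ℂ) * Complex.I by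
      rw [abs_of_neg ht]; push_cast; ring, Complex.cpow_def_of_ne_zero h0,
    Complex.log_ofReal_mul ht' Complex.I_ne_zero, Complex.log_I,
    Real.rpow_def_of_pos ht', Complex.ofReal_exp, ← Complex.exp_add]
  congr 1
  push_cast
  ring

/-- One term of the expansion, valid on the closed half-line. -/
theorem tailIntegral_coeff_of_nonneg {α : ℝ} (hα : 0 < α) (φ : ℝ → ℝ) {n : ℕ} (hn : 1 ≤ n) :
    ∃ G : ℝ → ℂ, ContDiff ℝ (⊤ : ℕ∞) G ∧
      (∀ t : ℝ, 0 ≤ t → ((taylorCoeff φ n : ℝ) : ℂ) / α * tailIntegral (n / α) t =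
        coeffA α φ n * ((t ^ ((n : ℝ) / α) : ℝ) : ℂ) +
        coeffB α φ n * ((t ^ ((n : ℝ) / α) * Real.log t : ℝ) : ℂ) + G t) ∧
      ((¬ ∃ m : ℕ, (n : ℝ) / α = m) → ∀ t : ℝ, t < 0 →
        ((taylorCoeff φ n : ℝ) : ℂ) / α * tailIntegral (n / α) t =
          coeffA α φ n * (Complex.exp (Complex.I * (((n : ℝ) * Real.pi / α : ℝ) : ℂ)) *
            ((|t| ^ ((n : ℝ) / α) : ℝ) : ℂ)) + G t) := by
  have hαc : (α : ℂ) ≠ 0 := Complex.ofReal_ne_zero.2 hα.ne'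
  have hs : 0 < (n : ℝ) / α := div_pos (by exact_mod_cast hn) hα
  by_cases hm : ∃ m : ℕ, (n : ℝ) / α = m
  · have hA : coeffA α φ n = 0 := if_pos hm
    have hB : coeffB α φ n = (-1 / (α : ℂ)) * ((taylorCoeff φ n : ℝ) : ℂ) *
      (Complex.I ^ ⌊(n : ℝ) / α⌋₊ / ((⌊(n : ℝ) / α⌋₊.factorial : ℕ) : ℂ)) := if_pos hm
    obtain ⟨m, hm'⟩ := id hm
    have hm1 : 1 ≤ m := by
      rw [hm'] at hs
      exact_mod_cast hs
    obtain ⟨G, hG, hGt⟩ := tailIntegral_nat m hm1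
    refine ⟨_, (contDiff_const (c := ((taylorCoeff φ n : ℝ) : ℂ) / α)).mul hG, fun t ht => ?_,
      fun h => absurd hm h⟩
    rw [hA, hB, hm', Nat.floor_natCast, hGt t ht]
    ring
  · have hB : coeffB α φ n = 0 := if_neg hm
    have hA : coeffA α φ n =
      Complex.exp (-((((n : ℝ) / (2 * α) * Real.pi : ℝ) : ℂ) * Complex.I)) / (α : ℂ)
        * ((taylorCoeff φ n : ℝ) : ℂ) * ((Real.Gamma (-((n : ℝ) / α)) : ℝ) : ℂ) := if_neg hm
    obtain ⟨G, hG, hGt⟩ := tailIntegral_of_not_nat hs hm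
    refine ⟨_, (contDiff_const (c := ((taylorCoeff φ n : ℝ) : ℂ) / α)).mul hG, fun t ht => ?_,
      fun _ t ht => ?_⟩
    · rw [hA, hB, hGt]
      rcases ht.eq_or_lt with rfl | ht
      · rw [Complex.ofReal_zero, mul_zero, neg_zero,
          Complex.zero_cpow (Complex.ofReal_ne_zero.2 hs.ne'), Real.zero_rpow hs.ne']
        simp
      · rw [neg_I_mul_cpow_of_pos ht, show (n : ℝ) / α * Real.pi / 2 = n / (2 * α) * Real.pi by
          field_simp, neg_mul]
        ring
    · have hexp : Complex.exp (((n / α * Real.pi / 2 : ℝ) : ℂ) * Complex.I) =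
          Complex.exp (-((((n : ℝ) / (2 * α) * Real.pi : ℝ) : ℂ) * Complex.I)) *
            Complex.exp (Complex.I * (((n : ℝ) * Real.pi / α : ℝ) : ℂ)) := by
        rw [← Complex.exp_add]
        congr 1
        push_cast
        field_simp
        ring
      rw [hA, hGt, neg_I_mul_cpow_of_neg ht, hexp]
      ring

/-- A single `ψ` on the whole line serves both parts. Only the formula for `t < 0` needs all `n/α`
to be non-integral, since the logarithmic expansion is established for `t ≥ 0` alone. -/
theorem exists_expansion {α : ℝ} (hα : 0 < α) {φ : ℝ → ℝ}
    (hφ : ContDiff ℝ ∞ φ) (hφc : HasCompactSupport φ) {N : ℕ} (hN : 1 ≤ N) :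
    ∃ ψ : ℝ → ℂ, ContDiff ℝ ((⌈((N : ℝ) + 1) / α⌉₊ - 1 : ℕ) : WithTop ℕ∞) ψ ∧
      (∀ t : ℝ, 0 ≤ t → oscIntegral α φ t =
        (∑ n ∈ Finset.Icc 1 N, coeffA α φ n * ((t ^ ((n : ℝ) / α) : ℝ) : ℂ)) +
        (∑ n ∈ Finset.Icc 1 N,
          coeffB α φ n * ((t ^ ((n : ℝ) / α) * Real.log t : ℝ) : ℂ)) + ψ t) ∧
      ((∀ n ∈ Finset.Icc 1 N, ¬ ∃ m : ℕ, (n : ℝ) / α = m) → ∀ t : ℝ, t < 0 →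
        oscIntegral α φ t =
          (∑ n ∈ Finset.Icc 1 N, coeffA α φ n *
            (Complex.exp (Complex.I * (((n : ℝ) * Real.pi / α : ℝ) : ℂ)) *
              ((|t| ^ ((n : ℝ) / α) : ℝ) : ℂ))) + ψ t) := by
  obtain ⟨R, hR, hRt⟩ := oscIntegral_eq_sum_tailIntegral hα hφ hφc hN
  choose! G hG hpos hneg using fun (n : ℕ) (hn : 1 ≤ n) => tailIntegral_coeff_of_nonneg hα φ hn
  refine ⟨fun t => ∑ n ∈ Finset.Icc 1 N, G n t + R t, ?_, fun t ht => ?_, fun hirr t ht => ?_⟩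
  · refine (ContDiff.sum fun n hn => ?_).add hR
    exact (hG n (Finset.mem_Icc.1 hn).1).of_le (WithTop.coe_le_coe.2 le_top)
  · rw [hRt, Finset.sum_congr rfl fun n hn => hpos n (Finset.mem_Icc.1 hn).1 t ht,
      Finset.sum_add_distrib, Finset.sum_add_distrib]
    ring
  · rw [hRt, Finset.sum_congr rfl fun n hn =>
      hneg n (Finset.mem_Icc.1 hn).1 (hirr n hn) t ht, Finset.sum_add_distrib]
    ring

theorem Irrational.natCast_div_ne_natCast {α : ℝ} (hα : Irrational α) {n : ℕ} (hn : 1 ≤ n) :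
    ¬ ∃ m : ℕ, (n : ℝ) / α = m := by
  rintro ⟨m, hm⟩
  have h := hα.natCast_div (m := n) (by omega)
  exact h ⟨m, by rw [hm]; norm_cast⟩

end

theorem theorem1p1 (α : ℝ) (hα : 0 < α) (φ : ℝ → ℝ)
    (hφ : ContDiff ℝ ∞ φ) (hφc : HasCompactSupport φ) :
    ((∃ q : ℚ, (q : ℝ) = α) → ∀ N : ℕ, 1 ≤ N →
      ∃ ψ : ℝ → ℂ,
        ContDiffOn ℝ ((⌈((N : ℝ) + 1) / α⌉₊ - 1 : ℕ) : WithTop ℕ∞) ψ (Set.Ici 0) ∧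
        ∀ t : ℝ, 0 ≤ t →
          oscIntegral α φ t =
            (∑ n ∈ Finset.Icc 1 N, coeffA α φ n * ((t ^ ((n : ℝ) / α) : ℝ) : ℂ)) +
            (∑ n ∈ Finset.Icc 1 N,
              coeffB α φ n * ((t ^ ((n : ℝ) / α) * Real.log t : ℝ) : ℂ)) + ψ t) ∧
    (Irrational α → ∀ N : ℕ, 1 ≤ N →
      ∃ ψ : ℝ → ℂ,
        ContDiff ℝ ((⌈((N : ℝ) + 1) / α⌉₊ - 1 : ℕ) : WithTop ℕ∞) ψ ∧
        (∀ t : ℝ, 0 ≤ t →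
          oscIntegral α φ t =
            (∑ n ∈ Finset.Icc 1 N, coeffA α φ n * ((t ^ ((n : ℝ) / α) : ℝ) : ℂ)) + ψ t) ∧
        (∀ t : ℝ, t < 0 →
          oscIntegral α φ t =
            (∑ n ∈ Finset.Icc 1 N, coeffA α φ n *
              (Complex.exp (Complex.I * (((n : ℝ) * Real.pi / α : ℝ) : ℂ)) *
                ((|t| ^ ((n : ℝ) / α) : ℝ) : ℂ))) + ψ t)) := by
  refine ⟨fun _ N hN => ?_, fun hirr N hN => ?_⟩
  · obtain ⟨ψ, hψ, hpos, -⟩ := exists_expansion hα hφ hφc hN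
    exact ⟨ψ, hψ.contDiffOn, hpos⟩
  · obtain ⟨ψ, hψ, hpos, hneg⟩ := exists_expansion hα hφ hφc hN
    have hn : ∀ n ∈ Finset.Icc 1 N, ¬ ∃ m : ℕ, (n : ℝ) / α = m := fun n hn =>
      hirr.natCast_div_ne_natCast (Finset.mem_Icc.1 hn).1
    refine ⟨ψ, hψ, fun t ht => ?_, hneg hn⟩
    have hB : ∀ n ∈ Finset.Icc 1 N,
        coeffB α φ n * ((t ^ ((n : ℝ) / α) * Real.log t : ℝ) : ℂ) = 0 := fun n h => by
      rw [show coeffB α φ n = 0 from if_neg (hn n h), zero_mul]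
    rw [hpos t ht, Finset.sum_eq_zero hB, add_zero]
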